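/- Let $\Theta\subset\mathbb R^d$ be closed and convex, let $W\in\mathbb R^{d\times d}$ be invertible with largest and smallest singular values $\sigma_{\max}(W)$, $\sigma_{\min}(W)$, let $\theta^*\in\Theta$ and $\rho>0$. Observe $y_k=W\theta^*+w_k$, $k\ge 0$, where the random vectors $w_k$ have a common law $\nu$ with $\int w\,d\nu=0$ and $\int\|w\|^2d\nu=\sigma_w^2\in(0,\infty)$, and $\mathbb E[w_k\mid w_0,\dots,w_{k-1}]=0$ for all $k$ (for instance, independent $w_k$). Let $\mathcal P_2(\mathbb R^d)$ be the probability measures with finite second moment, $W_2$ the type 2 Wasserstein distance, and let $\mu^*$ be a minimizer of $$J(\mu)=\tfrac12\int\!\!\int\|W\theta^*+w-W\theta\|^2\,d\mu(\theta)\,d\nu(w)+\tfrac{\rho}{2}\operatorname{Var}_\mu(\theta_1+\dots+\theta_d)$$ over all $\mu\in\mathcal P_2(\mathbb R^d)$ with $\operatorname{supp}\mu\subset\Theta$. Let $\tau\in\bigl(0,\,1/(2\max\{\sigma_{\max}(W)^2,\rho\})\bigr)$, let $\mu_0\in\mathcal P_2(\mathbb R^d)$, and let $$\mu_{k+1}=\bigl(\mathrm{proj}_\Theta\circ(\mathrm{Id}-\tau\xi_k)\bigr)_\#\mu_k,\qquad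 \xi_k(\theta)=W^\top(W\theta-y_k)+\rho\Bigl(\theta-\int\theta'\,d\mu_k(\theta')\Bigr).$$ Put $\eta=4\max\{\sigma_{\max}(W)^2,\rho\}/\sigma_{\min}(W)^2$. Then all $\mu_k$ lie in $\mathcal P_2(\mathbb R^d)$; $\mu_{k+1}$ is the unique $W_2$-projection of $(\mathrm{Id}-\tau\xi_k)_\#\mu_k$ onto the measures in $\mathcal P_2(\mathbb R^d)$ with support in $\Theta$; and for all $k\ge0$ $$\mathbb E\bigl[W_2(\mu_{k+1},\mu^*)^2\bigr]\le(1-\sigma_{\min}(W)^2\tau)^{k+1}\bigl(W_2(\mu_0,\mu^*)^2-\tau\eta\sigma_w^2\bigr)+\tau\eta\sigma_w^2;$$ for all $k\ge1$ the same bound also holds with the exponent $k+1$ replaced by $k$. Moreover (all the expectations being finite): 1. $\limsup_{k\to\infty}\mathbb E[W_2(\mu_{k+1},\mu^*)]\le\sigma_w\sqrt{\eta\tau}$; 2. with $m_k,m^*$ the means and $S_k,S^*$ the covariance matrices of $\mu_k,\mu^*$, $\limsup_{k\to\infty}\mathbb E\bigl[\sqrt{\|m_{k+1}-m^*\|^2+d(S_{k+1},S^*)^2}\bigr]\le\sigma_w\sqrt{\eta\tau}$,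 where $d(S,T)=\sqrt{\operatorname{tr}\bigl(S+T-2(S^{1/2}TS^{1/2})^{1/2}\bigr)}$ is the Bures distance; 3. for every $L$-Lipschitz $\varphi:\mathbb R^d\to\mathbb R$, $\limsup_{k\to\infty}\mathbb E\bigl[\bigl|\|\varphi\|_{L^2(\mu_{k+1})}-\|\varphi\|_{L^2(\mu^*)}\bigr|\bigr]\le L\sigma_w\sqrt{\eta\tau}$. -/

import Mathlib

open MeasureTheory ProbabilityTheory Filter Topology Set
open scoped NNReal ENNReal Matrix

namespace WassersteinSGD

/-- The Euclidean space `ℝᵈ`. -/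
abbrev E (d : ℕ) : Type := EuclideanSpace ℝ (Fin d)

section Spaces

variable {d : ℕ}

/-- `μ` is a Borel probability measure on `ℝᵈ` with finite second moment. -/
def InP2 (μ : Measure (E d)) : Prop :=
  IsProbabilityMeasure μ ∧ Integrable (fun x => ‖x‖ ^ 2) μ

/-- `γ` is a transport plan between `μ` and `ν`. -/
def IsPlan (μ ν : Measure (E d)) (γ : Measure (E d × E d)) : Prop :=
  IsProbabilityMeasure γ ∧ γ.map Prod.fst = μ ∧ γ.map Prod.snd = ν

/-- The type 2 Wasserstein distance, with values in `[0, ∞]`. -/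
noncomputable def eW2 (μ ν : Measure (E d)) : ℝ≥0∞ :=
  (⨅ (γ : Measure (E d × E d)) (_ : IsPlan μ ν γ), ∫⁻ p, edist p.1 p.2 ^ 2 ∂γ) ^ (1 / 2 : ℝ)

/-- The type 2 Wasserstein distance as a real number; it is used between measures with finite
second moment, for which `eW2` is finite. -/
noncomputable def W2 (μ ν : Measure (E d)) : ℝ := (eW2 μ ν).toReal

/-- A nearest point of `Θ` to `x`: the Euclidean projection onto a closed convex set `Θ`. -/
noncomputable def proj (Θ : Set (E d)) (x : E d) : E d :=
  Classical.epsilon fun y => y ∈ Θ ∧ ∀ z ∈ Θ, ‖x - y‖ ≤ ‖x - z‖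

/-- On a nonempty closed set, `proj Θ x` really is a nearest point. -/
theorem proj_spec {Θ : Set (E d)} (hc : IsClosed Θ) (hne : Θ.Nonempty) (x : E d) :
    proj Θ x ∈ Θ ∧ ∀ z ∈ Θ, ‖x - proj Θ x‖ ≤ ‖x - z‖ := by
  refine Classical.epsilon_spec (p := fun y => y ∈ Θ ∧ ∀ z ∈ Θ, ‖x - y‖ ≤ ‖x - z‖) ?_
  obtain ⟨y, hy, h⟩ := hc.exists_infDist_eq_dist hne x
  refine ⟨y, hy, fun z hz => ?_⟩
  rw [← dist_eq_norm, ← dist_eq_norm, ← h]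
  exact Metric.infDist_le_dist_of_mem hz

/-- `ν` is a projection of `μ`, with respect to the Wasserstein distance, onto the set of
measures in `P₂(ℝᵈ)` with support contained in `Θ`. -/
def IsSupportProj (Θ : Set (E d)) (μ ν : Measure (E d)) : Prop :=
  InP2 ν ∧ ν.support ⊆ Θ ∧
    ∀ ν' : Measure (E d), InP2 ν' → ν'.support ⊆ Θ → eW2 μ ν ≤ eW2 μ ν'

/-- The mean of `μ`. -/
noncomputable def mean (μ : Measure (E d)) : E d := ∫ x, x ∂μ

/-- The covariance matrix of `μ`. -/
noncomputable def covMat (μ : Measure (E d)) : Matrix (Fin d) (Fin d) ℝ :=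
  Matrix.of fun i j => covariance (fun x : E d => x i) (fun x : E d => x j) μ

open scoped MatrixOrder in
/-- The Bures distance between symmetric positive semidefinite matrices
(`CFC.sqrt` is the positive semidefinite square root). -/
noncomputable def bures (S T : Matrix (Fin d) (Fin d) ℝ) : ℝ :=
  √(S + T - (2 : ℝ) • CFC.sqrt (CFC.sqrt S * T * CFC.sqrt S)).trace

/-- The `L²(μ)` norm of a real-valued function. -/
noncomputable def l2norm (φ : E d → ℝ) (μ : Measure (E d)) : ℝ := √(∫ x, φ x ^ 2 ∂μ)

end Spaces

section Model

variable {d : ℕ}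

/-- The action of a matrix on Euclidean space. -/
noncomputable def act (W : Matrix (Fin d) (Fin d) ℝ) : E d →ₗ[ℝ] E d := Matrix.toEuclideanLin W

/-- The largest singular value (`LinearMap.singularValues` lists the `d` singular values in
descending order, starting at index `0`). -/
noncomputable def sigmaMax (W : Matrix (Fin d) (Fin d) ℝ) : ℝ := (act W).singularValues 0

/-- The smallest singular value. -/
noncomputable def sigmaMin (W : Matrix (Fin d) (Fin d) ℝ) : ℝ := (act W).singularValues (d - 1)

/-- The variance-regularized least-squares functional. -/
noncomputable def J (W : Matrix (Fin d) (Fin d) ℝ) (ρ : ℝ) (θs : E d) (ν μ : Measure (E d)) : ℝ :=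
  1 / 2 * ∫ w, ∫ θ, ‖act W θs + w - act W θ‖ ^ 2 ∂μ ∂ν
    + ρ / 2 * variance (fun θ : E d => ∑ i, θ i) μ

/-- `μs` minimizes `J` over the measures in `P₂(ℝᵈ)` with support contained in `Θ`. -/
def IsOptimal (Θ : Set (E d)) (W : Matrix (Fin d) (Fin d) ℝ) (ρ : ℝ) (θs : E d)
    (ν μs : Measure (E d)) : Prop :=
  InP2 μs ∧ μs.support ⊆ Θ ∧
    ∀ μ : Measure (E d), InP2 μ → μ.support ⊆ Θ → J W ρ θs ν μs ≤ J W ρ θs ν μ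

/-- The stochastic gradient at `μ`, evaluated at `θ`, built from the observation `y`. -/
noncomputable def grad (W : Matrix (Fin d) (Fin d) ℝ) (ρ : ℝ) (μ : Measure (E d)) (y θ : E d) :
    E d :=
  act Wᵀ (act W θ - y) + ρ • (θ - mean μ)

/-- The unprojected gradient step: the pushforward of `μ` under `Id - τ ξ(·, y)`. -/
noncomputable def gradStep (W : Matrix (Fin d) (Fin d) ℝ) (ρ τ : ℝ) (μ : Measure (E d))
    (y : E d) : Measure (E d) :=
  μ.map fun θ => θ - τ • grad W ρ μ y θ

/-- The particle-wise projected stochastic gradient iteration driven by the data stream `y`. -/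
noncomputable def iter (Θ : Set (E d)) (W : Matrix (Fin d) (Fin d) ℝ) (ρ τ : ℝ)
    (μ₀ : Measure (E d)) (y : ℕ → E d) : ℕ → Measure (E d)
  | 0 => μ₀
  | k + 1 =>
    (iter Θ W ρ τ μ₀ y k).map fun θ =>
      proj Θ (θ - τ • grad W ρ (iter Θ W ρ τ μ₀ y k) (y k) θ)

/-- The constant `η = 4 max{σ_max(W)², ρ} / σ_min(W)²`. -/
noncomputable def eta (W : Matrix (Fin d) (Fin d) ℝ) (ρ : ℝ) : ℝ :=
  4 * max (sigmaMax W ^ 2) ρ / sigmaMin W ^ 2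

end Model

end WassersteinSGD

/-! The true parameter is feasible, the noise is centred and `W` is injective, so the unique
minimizer is the Dirac mass at `θs` (`IsOptimal.eq_dirac`). Only one coupling with a Dirac mass
exists, hence the squared Wasserstein distance is the plain second moment `V k = ∫ ‖θ - θs‖ ^ 2
∂μ_k` (`sq_W2_dirac`), and no optimal transport theory is needed for the rates.

For one step, projecting does not increase the distance to `θs`, and the drift contracts by `c = 1 -
sigmaMin W ^ 2 * τ` up to terms linear in `θ - mean μ`, which integrate to zero. What remains is a
term linear in the noise and `τ ^ 2 * sigmaMax W ^ 2 * ‖w‖ ^ 2` (`integral_sq_norm_step_le`). The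
linear term pairs `w k` with a vector depending only on earlier noise, so its expectation vanishes,
leaving an affine recursion for `E[V k]`. Solving it gives both finite-time bounds; Jensen gives the
first limsup. Against a Dirac mass the mean-Bures quantity equals the Wasserstein distance, and the
gap of `L²` norms is at most `L` times it.

The projection claim is separate: the Pythagorean inequality for the convex set, integrated over a
plan, shows that near-optimal plans to a competitor yield cheap plans from `μ.map (proj Θ)` to it.
-/

namespace WassersteinSGD

open scoped RealInnerProductSpace
open Module

variable {d : ℕ}

/-! ### Euclidean projection onto a closed convex set. -/

section Projection

variable {Θ : Set (E d)}

/-- The variational inequality characterizing the projection onto a closed convex set. -/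
theorem inner_sub_proj_le_zero (hc : IsClosed Θ) (hconv : Convex ℝ Θ) (hne : Θ.Nonempty)
    (x : E d) {z : E d} (hz : z ∈ Θ) : ⟪x - proj Θ x, z - proj Θ x⟫ ≤ 0 := by
  obtain ⟨hp, hmin⟩ := proj_spec hc hne x
  refine (norm_eq_iInf_iff_real_inner_le_zero hconv hp).1 ?_ z hz
  have : Nonempty Θ := hne.to_subtype
  refine le_antisymm (le_ciInf fun z => hmin z z.2) ?_
  exact ciInf_le ⟨0, by rintro _ ⟨z, rfl⟩; exact norm_nonneg _⟩ (⟨_, hp⟩ : Θ)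

/-- The angle at `proj Θ x` is not acute, which turns Pythagoras into an inequality. It drives both
the one-step estimate and the uniqueness of the Wasserstein projection. -/
theorem sq_norm_sub_proj_add_le (hc : IsClosed Θ) (hconv : Convex ℝ Θ) (hne : Θ.Nonempty)
    (x : E d) {z : E d} (hz : z ∈ Θ) :
    ‖x - proj Θ x‖ ^ 2 + ‖proj Θ x - z‖ ^ 2 ≤ ‖x - z‖ ^ 2 := by
  have h := inner_sub_proj_le_zero hc hconv hne x hz
  have h2 : x - z = (x - proj Θ x) - (z - proj Θ x) := by abel
  have h3 := norm_sub_sq_real (x - proj Θ x) (z - proj Θ x)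
  rw [h2, h3, norm_sub_rev (proj Θ x) z]
  linarith

theorem norm_proj_sub_le (hc : IsClosed Θ) (hconv : Convex ℝ Θ) (hne : Θ.Nonempty)
    (x : E d) {z : E d} (hz : z ∈ Θ) : ‖proj Θ x - z‖ ^ 2 ≤ ‖x - z‖ ^ 2 := by
  have := sq_norm_sub_proj_add_le hc hconv hne x hz
  nlinarith [sq_nonneg ‖x - proj Θ x‖]

theorem lipschitzWith_proj (hc : IsClosed Θ) (hconv : Convex ℝ Θ) (hne : Θ.Nonempty) :
    LipschitzWith 1 (proj Θ) := by
  refine LipschitzWith.of_dist_le_mul fun x y => ?_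
  simp only [NNReal.coe_one, one_mul, dist_eq_norm]
  have h1 := inner_sub_proj_le_zero hc hconv hne x (proj_spec hc hne y).1
  have h2 := inner_sub_proj_le_zero hc hconv hne y (proj_spec hc hne x).1
  set p := proj Θ x
  set q := proj Θ y
  have h3 : ⟪x - y, p - q⟫ = ‖p - q‖ ^ 2 - ⟪x - p, q - p⟫ - ⟪y - q, p - q⟫ := by
    rw [← real_inner_self_eq_norm_sq]
    simp only [inner_sub_left, inner_sub_right]
    ring
  have h4 := real_inner_le_norm (x - y) (p - q)
  by_contra! h
  nlinarith [norm_nonneg (x - y), norm_nonneg (p - q)]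

theorem measurable_proj (hc : IsClosed Θ) (hconv : Convex ℝ Θ) (hne : Θ.Nonempty) :
    Measurable (proj Θ) :=
  (lipschitzWith_proj hc hconv hne).continuous.measurable

end Projection

/-! ### Norm bounds from singular values. -/

section SingularValues

/-- The `c i` are the coordinates of `x` in an eigenbasis of `T* T`, whose eigenvalues are the
squared singular values. -/
theorem sq_norm_eq_sum_singularValues (T : E d →ₗ[ℝ] E d) (x : E d) :
    ∃ c : Fin d → ℝ, ‖x‖ ^ 2 = ∑ i, c i ^ 2 ∧
      ‖T x‖ ^ 2 = ∑ i : Fin d, T.singularValues i ^ 2 * c i ^ 2 := by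
  have hn : finrank ℝ (E d) = d := finrank_euclideanSpace_fin
  let hT := T.isSymmetric_adjoint_comp_self
  let b := hT.eigenvectorBasis hn
  refine ⟨fun i => ⟪b i, x⟫, (b.sum_sq_inner_right x).symm, ?_⟩
  have h1 : ‖T x‖ ^ 2 = ⟪x, (LinearMap.adjoint T ∘ₗ T) x⟫ := by
    rw [LinearMap.comp_apply, LinearMap.adjoint_inner_right, real_inner_self_eq_norm_sq]
  rw [h1, ← b.sum_inner_mul_inner]
  refine Finset.sum_congr rfl fun i _ => ?_
  have h2 : ⟪b i, (LinearMap.adjoint T ∘ₗ T) x⟫ = hT.eigenvalues hn i * ⟪b i, x⟫ := by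
    rw [← hT (b i) x, hT.apply_eigenvectorBasis hn i, inner_smul_left]
    simp [b]
  rw [h2, T.sq_singularValues_fin hn, real_inner_comm]
  ring

theorem sigmaMin_le_sigmaMax (W : Matrix (Fin d) (Fin d) ℝ) : sigmaMin W ≤ sigmaMax W :=
  (act W).singularValues_antitone (Nat.zero_le _)

theorem sq_norm_act_le (W : Matrix (Fin d) (Fin d) ℝ) (x : E d) :
    ‖act W x‖ ^ 2 ≤ sigmaMax W ^ 2 * ‖x‖ ^ 2 := by
  obtain ⟨c, h1, h2⟩ := sq_norm_eq_sum_singularValues (act W) x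
  rw [h1, h2, Finset.mul_sum]
  gcongr with i
  · exact LinearMap.singularValues_nonneg _ _
  · exact (act W).singularValues_antitone (Nat.zero_le _)

theorem le_sq_norm_act (W : Matrix (Fin d) (Fin d) ℝ) (x : E d) :
    sigmaMin W ^ 2 * ‖x‖ ^ 2 ≤ ‖act W x‖ ^ 2 := by
  obtain ⟨c, h1, h2⟩ := sq_norm_eq_sum_singularValues (act W) x
  rw [h1, h2, Finset.mul_sum]
  gcongr with i
  · exact LinearMap.singularValues_nonneg _ _
  · exact (act W).singularValues_antitone (Nat.le_sub_one_of_lt i.2)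

theorem act_injective {W : Matrix (Fin d) (Fin d) ℝ} (hW : IsUnit W) :
    Function.Injective (act W) := by
  obtain ⟨V, -, hV⟩ := isUnit_iff_exists.1 hW
  refine Function.LeftInverse.injective (g := act V) fun x => ?_
  simp [act, Matrix.toLpLin_apply, hV]

theorem sigmaMin_pos {W : Matrix (Fin d) (Fin d) ℝ} (hW : IsUnit W) (hd : 0 < d) :
    0 < sigmaMin W := by
  refine (act W).injective_iff_forall_lt_finrank_singularValues_pos.1 (act_injective hW) _ ?_
  rw [finrank_euclideanSpace_fin]
  omega

theorem inner_act_transpose (W : Matrix (Fin d) (Fin d) ℝ) (x y : E d) :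
    ⟪act Wᵀ x, y⟫ = ⟪x, act W y⟫ := by
  rw [act, ← Matrix.conjTranspose_eq_transpose_of_trivial,
    Matrix.toEuclideanLin_conjTranspose_eq_adjoint, LinearMap.adjoint_inner_left]
  rfl

/-- Duality: `‖Wᵀ x‖ ^ 2 = ⟪x, W Wᵀ x⟫`, so Cauchy-Schwarz and the bound for `W` suffice, without
comparing the singular values of `W` and `Wᵀ`. -/
theorem sq_norm_act_transpose_le (W : Matrix (Fin d) (Fin d) ℝ) (x : E d) :
    ‖act Wᵀ x‖ ^ 2 ≤ sigmaMax W ^ 2 * ‖x‖ ^ 2 := by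
  have h1 := inner_act_transpose W x (act Wᵀ x)
  rw [real_inner_self_eq_norm_sq] at h1
  have h2 := real_inner_le_norm x (act W (act Wᵀ x))
  have h3 := sq_norm_act_le W (act Wᵀ x)
  rcases (sq_nonneg ‖act Wᵀ x‖).eq_or_lt with h | h
  · rw [← h]; positivity
  refine le_of_mul_le_mul_right ?_ h
  calc ‖act Wᵀ x‖ ^ 2 * ‖act Wᵀ x‖ ^ 2 ≤ (‖x‖ * ‖act W (act Wᵀ x)‖) ^ 2 := by
        rw [← sq]; gcongr; linarith
    _ ≤ _ := by rw [mul_pow]; nlinarith [sq_nonneg ‖x‖]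

theorem continuous_act (W : Matrix (Fin d) (Fin d) ℝ) : Continuous (act W) :=
  (act W).continuous_of_finiteDimensional

end SingularValues

/-! ### Measures with finite second moment. -/

section SecondMoment

variable {μ : Measure (E d)}

theorem InP2.memLp_id (h : InP2 μ) : MemLp (fun x : E d => x) 2 μ :=
  (memLp_two_iff_integrable_sq_norm measurable_id.aestronglyMeasurable).2 h.2

theorem InP2.integrable_id (h : InP2 μ) : Integrable (fun x : E d => x) μ :=
  have := h.1
  h.memLp_id.integrable one_le_two

theorem InP2.memLp_sub_const (h : InP2 μ) (a : E d) : MemLp (fun x : E d => x - a) 2 μ :=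
  have := h.1
  h.memLp_id.sub (memLp_const a)

theorem InP2.integrable_sq_norm_sub (h : InP2 μ) (a : E d) :
    Integrable (fun x : E d => ‖x - a‖ ^ 2) μ :=
  (memLp_two_iff_integrable_sq_norm (by fun_prop)).1 (h.memLp_sub_const a)

theorem InP2.map {f : E d → E d} (h : InP2 μ) (hf : MemLp f 2 μ) : InP2 (μ.map f) := by
  have := h.1
  refine ⟨Measure.isProbabilityMeasure_map hf.1.aemeasurable, ?_⟩
  rw [integrable_map_measure (by fun_prop) hf.1.aemeasurable]
  exact (memLp_two_iff_integrable_sq_norm hf.1).1 hf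

theorem inP2_dirac (a : E d) : InP2 (Measure.dirac a) :=
  ⟨inferInstance, integrable_dirac (by finiteness)⟩

theorem InP2.memLp_act (h : InP2 μ) (W : Matrix (Fin d) (Fin d) ℝ) :
    MemLp (fun x => act W x) 2 μ :=
  (LinearMap.toContinuousLinearMap (act W)).comp_memLp' h.memLp_id

theorem InP2.memLp_act_sub (h : InP2 μ) (W : Matrix (Fin d) (Fin d) ℝ) (a : E d) :
    MemLp (fun x => act W (a - x)) 2 μ := by
  have := h.1
  simp_rw [map_sub]
  exact (memLp_const (act W a)).sub (h.memLp_act W)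

theorem integral_sq_norm_const_add [IsProbabilityMeasure μ] {f : E d → E d} (hf : MemLp f 2 μ)
    (c : E d) :
    ∫ x, ‖c + f x‖ ^ 2 ∂μ = ‖c‖ ^ 2 + 2 * ⟪c, ∫ x, f x ∂μ⟫ + ∫ x, ‖f x‖ ^ 2 ∂μ := by
  have h1 := hf.integrable one_le_two
  have h2 := (memLp_two_iff_integrable_sq_norm hf.1).1 hf
  have h3 : Integrable (fun x => ⟪c, f x⟫) μ := h1.const_inner c
  simp_rw [norm_add_sq_real]
  rw [integral_add (by fun_prop) h2, integral_add (by fun_prop) (by fun_prop),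
    integral_const_mul, integral_inner h1]
  simp

end SecondMoment

/-! ### Transport plans, Dirac targets, and plans of vanishing cost. -/

section Wasserstein

variable {μ μ' : Measure (E d)}

theorem IsPlan.lintegral_fst {γ : Measure (E d × E d)} (h : IsPlan μ μ' γ) {f : E d → ℝ≥0∞}
    (hf : Measurable f) : ∫⁻ p, f p.1 ∂γ = ∫⁻ x, f x ∂μ := by
  rw [← h.2.1, lintegral_map hf measurable_fst]

theorem IsPlan.map_left {γ : Measure (E d × E d)} (h : IsPlan μ μ' γ) {f : E d → E d}
    (hf : Measurable f) : IsPlan (μ.map f) μ' (γ.map fun p => (f p.1, p.2)) := by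
  have hm : Measurable fun p : E d × E d => (f p.1, p.2) := by fun_prop
  have := h.1
  refine ⟨Measure.isProbabilityMeasure_map hm.aemeasurable, ?_, ?_⟩
  · rw [Measure.map_map measurable_fst hm, ← h.2.1, Measure.map_map hf measurable_fst]
    rfl
  · rw [Measure.map_map measurable_snd hm]
    exact h.2.2

theorem isPlan_map_prodMk [IsProbabilityMeasure μ] {f : E d → E d} (hf : Measurable f) :
    IsPlan μ (μ.map f) (μ.map fun x => (x, f x)) := by
  have hm : Measurable fun x => (x, f x) := by fun_prop
  refine ⟨Measure.isProbabilityMeasure_map hm.aemeasurable, ?_, ?_⟩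
  · rw [Measure.map_map measurable_fst hm]
    exact Measure.map_id
  · rw [Measure.map_map measurable_snd hm]
    rfl

theorem lintegral_edist_map_prodMk {f : E d → E d} (hf : Measurable f) :
    ∫⁻ p, edist p.1 p.2 ^ 2 ∂(μ.map fun x => (x, f x)) = ∫⁻ x, edist x (f x) ^ 2 ∂μ :=
  lintegral_map (by fun_prop) (by fun_prop)

/-- Every transport plan to a Dirac mass has the same cost. -/
theorem eW2_dirac [IsProbabilityMeasure μ] (a : E d) :
    eW2 μ (Measure.dirac a) = (∫⁻ x, edist x a ^ 2 ∂μ) ^ (1 / 2 : ℝ) := by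
  rw [eW2]
  congr 1
  refine le_antisymm ?_ (le_iInf₂ fun γ hγ => ?_)
  · have h := isPlan_map_prodMk (μ := μ) (f := fun _ => a) measurable_const
    rw [Measure.map_const, measure_univ, one_smul] at h
    refine (iInf₂_le _ h).trans_eq ?_
    exact lintegral_edist_map_prodMk measurable_const
  · have h1 : ∀ᵐ p ∂γ, p.2 = a := by
      have h2 : ∀ᵐ x ∂(γ.map Prod.snd), x = a := by
        rw [hγ.2.2, ae_dirac_eq]
        exact rfl
      exact ae_of_ae_map measurable_snd.aemeasurable h2
    rw [← hγ.lintegral_fst (f := fun x => edist x a ^ 2) (by fun_prop)]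
    refine (lintegral_congr_ae ?_).le
    filter_upwards [h1] with p hp
    rw [hp]

theorem edist_sq_eq (x y : E d) : edist x y ^ 2 = ENNReal.ofReal (‖x - y‖ ^ 2) := by
  rw [edist_dist, dist_eq_norm, ENNReal.ofReal_pow (norm_nonneg _)]

theorem W2_dirac (hμ : InP2 μ) (a : E d) :
    W2 μ (Measure.dirac a) = √(∫ x, ‖x - a‖ ^ 2 ∂μ) := by
  have := hμ.1
  simp_rw [W2, eW2_dirac, edist_sq_eq]
  rw [← ofReal_integral_eq_lintegral_ofReal (hμ.integrable_sq_norm_sub a)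
    (ae_of_all _ fun x => by positivity), ← ENNReal.toReal_rpow, ENNReal.toReal_ofReal
    (integral_nonneg fun x => by positivity), Real.sqrt_eq_rpow]

theorem sq_W2_dirac (hμ : InP2 μ) (a : E d) :
    W2 μ (Measure.dirac a) ^ 2 = ∫ x, ‖x - a‖ ^ 2 ∂μ := by
  rw [W2_dirac hμ, Real.sq_sqrt (integral_nonneg fun x => by positivity)]

theorem lintegral_edist_ne_top (hμ : InP2 μ) {f : E d → E d} (hf : MemLp f 2 μ) :
    ∫⁻ x, edist x (f x) ^ 2 ∂μ ≠ ∞ := by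
  simp_rw [edist_sq_eq]
  have h := hμ.memLp_id.sub hf
  exact ((memLp_two_iff_integrable_sq_norm h.1).1 h).lintegral_lt_top.ne

theorem enorm_exp_mul_I_sub_le (a b : ℝ) :
    ‖Complex.exp (a * Complex.I) - Complex.exp (b * Complex.I)‖ₑ ≤ ‖a - b‖ₑ := by
  rw [← ofReal_norm, ← ofReal_norm]
  refine ENNReal.ofReal_le_ofReal ?_
  have h : Complex.exp (a * Complex.I) - Complex.exp (b * Complex.I) =
      Complex.exp (b * Complex.I) * (Complex.exp (Complex.I * ((a - b : ℝ) : ℂ)) - 1) := by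
    rw [mul_sub, ← Complex.exp_add, mul_one]
    push_cast
    ring_nf
  rw [h, norm_mul, Complex.norm_exp_ofReal_mul_I, one_mul]
  exact Real.norm_exp_I_mul_ofReal_sub_one_le

/-- Since `s ↦ exp (s * I)` is 1-Lipschitz, the characteristic functions differ by at most the `L¹`
cost times `‖t‖`, and the `L¹` cost is at most the `L²` cost because `γ` is a probability measure.
-/
theorem IsPlan.enorm_charFun_sub_le {γ : Measure (E d × E d)} (h : IsPlan μ μ' γ) (t : E d) :
    ‖charFun μ t - charFun μ' t‖ₑ ≤ (∫⁻ p, edist p.1 p.2 ^ 2 ∂γ) ^ (1 / 2 : ℝ) * ‖t‖ₑ := by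
  have := h.1
  have hb : ∀ f : E d × E d → ℝ, Measurable f →
      Integrable (fun p => Complex.exp (f p * Complex.I)) γ := fun f hf =>
    .of_bound (by fun_prop) 1 (ae_of_all _ fun p => (Complex.norm_exp_ofReal_mul_I _).le)
  have h1 : charFun μ t = ∫ p, Complex.exp ((⟪p.1, t⟫ : ℝ) * Complex.I) ∂γ := by
    rw [charFun_apply, ← h.2.1, integral_map (by fun_prop) (by fun_prop)]
  have h2 : charFun μ' t = ∫ p, Complex.exp ((⟪p.2, t⟫ : ℝ) * Complex.I) ∂γ := by
    rw [charFun_apply, ← h.2.2, integral_map (by fun_prop) (by fun_prop)]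
  rw [h1, h2, ← integral_sub (hb _ (by fun_prop)) (hb _ (by fun_prop))]
  calc _ ≤ ∫⁻ p, edist p.1 p.2 * ‖t‖ₑ ∂γ := by
        refine (enorm_integral_le_lintegral_enorm _).trans (lintegral_mono fun p => ?_)
        refine (enorm_exp_mul_I_sub_le _ _).trans ?_
        rw [← inner_sub_left, edist_eq_enorm_sub]
        simp_rw [enorm_eq_nnnorm]
        exact_mod_cast nnnorm_inner_le_nnnorm (𝕜 := ℝ) _ _
    _ = (∫⁻ p, edist p.1 p.2 ∂γ) * ‖t‖ₑ := lintegral_mul_const _ (by fun_prop)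
    _ ≤ _ := by
        gcongr
        have h3 := eLpNorm_le_eLpNorm_of_exponent_le (p := 1) (q := 2) (μ := γ)
          (f := fun p => p.1 - p.2) one_le_two (by fun_prop)
        rw [eLpNorm_one_eq_lintegral_enorm,
          eLpNorm_eq_lintegral_rpow_enorm_toReal two_ne_zero ENNReal.ofNat_ne_top] at h3
        simpa [edist_eq_enorm_sub] using h3

/-- Measures connected by transport plans of arbitrarily small cost coincide. -/
theorem eq_of_forall_exists_isPlan [IsFiniteMeasure μ] [IsFiniteMeasure μ']
    (h : ∀ ε : ℝ≥0, 0 < ε → ∃ γ, IsPlan μ μ' γ ∧ ∫⁻ p, edist p.1 p.2 ^ 2 ∂γ ≤ ε) : μ = μ' := by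
  refine Measure.ext_of_charFun (funext fun t => ?_)
  rw [← sub_eq_zero, ← enorm_eq_zero, ← nonpos_iff_eq_zero]
  have hlim : Tendsto (fun ε : ℝ≥0 => (ε : ℝ≥0∞) ^ (1 / 2 : ℝ) * ‖t‖ₑ) (𝓝[>] 0) (𝓝 0) := by
    have h1 : Tendsto (fun ε : ℝ≥0 => (ε : ℝ≥0∞) ^ (1 / 2 : ℝ)) (𝓝 0) (𝓝 0) := by
      have := (ENNReal.continuous_rpow_const (y := 1 / 2)).comp ENNReal.continuous_coe
      simpa [Function.comp_def] using this.tendsto 0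
    simpa using ENNReal.Tendsto.mul_const (h1.mono_left nhdsWithin_le_nhds)
      (.inr (enorm_ne_top (x := t)))
  refine ge_of_tendsto hlim (eventually_mem_nhdsWithin.mono fun ε hε => ?_)
  obtain ⟨γ, hγ, hle⟩ := h ε hε
  exact (hγ.enorm_charFun_sub_le t).trans (by gcongr)

end Wasserstein

/-! ### Wasserstein projection onto measures supported in `Θ`. -/

section SupportProjection

variable {Θ : Set (E d)} {μ μ' : Measure (E d)}

theorem ae_mem_of_support_subset (h : μ.support ⊆ Θ) : ∀ᵐ x ∂μ, x ∈ Θ :=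
  mem_of_superset Measure.support_mem_ae h

theorem memLp_proj_comp (hc : IsClosed Θ) (hconv : Convex ℝ Θ) (hne : Θ.Nonempty)
    [IsFiniteMeasure μ] {f : E d → E d} (hf : MemLp f 2 μ) :
    MemLp (fun x => proj Θ (f x)) 2 μ := by
  obtain ⟨z, hz⟩ := hne
  have hm := (lipschitzWith_proj hc hconv ⟨z, hz⟩).continuous
  have h : MemLp (fun x => proj Θ (f x) - z) 2 μ := by
    refine (hf.sub (memLp_const z)).of_le
      ((hm.comp_aestronglyMeasurable hf.1).sub aestronglyMeasurable_const) (ae_of_all _ fun x => ?_)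
    exact le_of_sq_le_sq (norm_proj_sub_le hc hconv ⟨z, hz⟩ _ hz) (norm_nonneg _)
  simpa [Pi.add_def] using h.add (memLp_const z)

theorem support_map_proj_subset (hc : IsClosed Θ) (hconv : Convex ℝ Θ) (hne : Θ.Nonempty) :
    (μ.map (proj Θ)).support ⊆ Θ := by
  refine Measure.support_subset_of_isClosed hc ?_
  rw [mem_ae_map_iff (measurable_proj hc hconv hne).aemeasurable hc.measurableSet]
  exact univ_mem' fun x => (proj_spec hc hne x).1

/-- The first summand does not depend on the plan; the second is the cost of the plan obtained by
projecting the first coordinate. -/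
theorem IsPlan.lintegral_edist_proj_add_le (hc : IsClosed Θ) (hconv : Convex ℝ Θ)
    (hne : Θ.Nonempty) {γ : Measure (E d × E d)} (hγ : IsPlan μ μ' γ) (hs : μ'.support ⊆ Θ) :
    ∫⁻ x, edist x (proj Θ x) ^ 2 ∂μ + ∫⁻ p, edist (proj Θ p.1) p.2 ^ 2 ∂γ ≤
      ∫⁻ p, edist p.1 p.2 ^ 2 ∂γ := by
  have hm := measurable_proj hc hconv hne
  have hmem : ∀ᵐ p ∂γ, p.2 ∈ Θ := by
    have := ae_mem_of_support_subset hs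
    rw [← hγ.2.2] at this
    exact ae_of_ae_map measurable_snd.aemeasurable this
  rw [← hγ.lintegral_fst (f := fun x => edist x (proj Θ x) ^ 2) (by fun_prop),
    ← lintegral_add_left (by fun_prop)]
  refine lintegral_mono_ae ?_
  filter_upwards [hmem] with p hp
  simp_rw [edist_sq_eq]
  rw [← ENNReal.ofReal_add (by positivity) (by positivity)]
  exact ENNReal.ofReal_le_ofReal (sq_norm_sub_proj_add_le hc hconv hne _ hp)

/-- The unique Wasserstein projection onto the measures supported in a closed convex set is the
pushforward under the pointwise projection. -/
theorem isSupportProj_iff (hc : IsClosed Θ) (hconv : Convex ℝ Θ) (hne : Θ.Nonempty)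
    (hμ : InP2 μ) : IsSupportProj Θ μ μ' ↔ μ' = μ.map (proj Θ) := by
  have := hμ.1
  have hm := measurable_proj hc hconv hne
  have hp := memLp_proj_comp hc hconv hne hμ.memLp_id
  set D := ∫⁻ x, edist x (proj Θ x) ^ 2 ∂μ with hD
  have hle : (⨅ (γ : Measure (E d × E d)) (_ : IsPlan μ (μ.map (proj Θ)) γ),
      ∫⁻ p, edist p.1 p.2 ^ 2 ∂γ) ≤ D :=
    (iInf₂_le _ (isPlan_map_prodMk hm)).trans_eq (lintegral_edist_map_prodMk hm)
  constructor
  · rintro ⟨h2, hs, hmin⟩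
    have h3 := hmin _ (hμ.map hp) (support_map_proj_subset hc hconv hne)
    rw [eW2, eW2, ENNReal.rpow_le_rpow_iff (by norm_num)] at h3
    have := h2.1
    have := (hμ.map hp).1
    -- A plan within `ε` of the cost `D` leaves at most `ε` for the projected plan, so existence of
    -- an optimal plan is not required. Subtracting `D` uses that it is finite.
    refine (eq_of_forall_exists_isPlan fun ε hε => ?_).symm
    have h4 : (⨅ (γ : Measure (E d × E d)) (_ : IsPlan μ μ' γ),
        ∫⁻ p, edist p.1 p.2 ^ 2 ∂γ) < D + ε :=
      (h3.trans hle).trans_lt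
        (ENNReal.lt_add_right (lintegral_edist_ne_top hμ hp) (by exact_mod_cast hε.ne'))
    simp only [iInf_lt_iff] at h4
    obtain ⟨γ, hγ, hlt⟩ := h4
    refine ⟨_, hγ.map_left hm, ?_⟩
    rw [lintegral_map (by fun_prop) (by fun_prop)]
    exact (ENNReal.add_le_add_iff_left (lintegral_edist_ne_top hμ hp)).1
      ((hγ.lintegral_edist_proj_add_le hc hconv hne hs).trans hlt.le)
  · rintro rfl
    refine ⟨hμ.map hp, support_map_proj_subset hc hconv hne, fun ν' _ hs => ?_⟩
    rw [eW2, eW2, ENNReal.rpow_le_rpow_iff (by norm_num)]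
    exact hle.trans (le_iInf₂ fun γ hγ =>
      le_self_add.trans (hγ.lintegral_edist_proj_add_le hc hconv hne hs))

end SupportProjection

/-! ### Identification of the minimizer. -/

section Minimizer

/-- The cross term between noise and misfit vanishes because `ν` is centred, so the noise
contributes only a constant. -/
theorem J_eq {W : Matrix (Fin d) (Fin d) ℝ} {ρ : ℝ} {θs : E d} {ν μ : Measure (E d)}
    (hν : InP2 ν) (hν0 : ∫ x, x ∂ν = 0) (hμ : InP2 μ) :
    J W ρ θs ν μ = 1 / 2 * (∫ x, ‖x‖ ^ 2 ∂ν + ∫ θ, ‖act W (θs - θ)‖ ^ 2 ∂μ) +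
      ρ / 2 * variance (fun θ : E d => ∑ i, θ i) μ := by
  have := hν.1
  have := hμ.1
  have hf := hμ.memLp_act_sub W θs
  have h1 : ∀ w : E d, ∫ θ, ‖act W θs + w - act W θ‖ ^ 2 ∂μ =
      ‖w‖ ^ 2 + 2 * ⟪∫ θ, act W (θs - θ) ∂μ, w⟫ + ∫ θ, ‖act W (θs - θ)‖ ^ 2 ∂μ := fun w => by
    rw [real_inner_comm, ← integral_sq_norm_const_add hf w]
    congr! 4
    rw [map_sub]
    abel
  have h2 : Integrable (fun w : E d => ‖w‖ ^ 2) ν := hν.2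
  have h3 : Integrable (fun w => ⟪∫ θ, act W (θs - θ) ∂μ, w⟫) ν := hν.integrable_id.const_inner _
  rw [J]
  simp_rw [h1]
  rw [integral_add (by fun_prop) (by fun_prop), integral_add h2 (by fun_prop), integral_const_mul,
    integral_inner hν.integrable_id, hν0]
  simp

/-- The true parameter is feasible and `W` is injective, so the regularized least-squares problem
has the Dirac mass at the true parameter as its only minimizer. -/
theorem IsOptimal.eq_dirac {Θ : Set (E d)} {W : Matrix (Fin d) (Fin d) ℝ} {ρ : ℝ} {θs : E d}
    {ν μs : Measure (E d)} (hopt : IsOptimal Θ W ρ θs ν μs) (hc : IsClosed Θ) (hW : IsUnit W)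
    (hθs : θs ∈ Θ) (hρ : 0 < ρ) (hν : InP2 ν) (hν0 : ∫ x, x ∂ν = 0) :
    μs = Measure.dirac θs := by
  obtain ⟨h2, -, hmin⟩ := hopt
  have := h2.1
  have hsupp : (Measure.dirac θs).support ⊆ Θ :=
    Measure.support_subset_of_isClosed hc (by simpa [mem_ae_dirac_iff hc.measurableSet] using hθs)
  have h := hmin _ (inP2_dirac θs) hsupp
  rw [J_eq hν hν0 h2, J_eq hν hν0 (inP2_dirac θs), variance_dirac, integral_dirac, sub_self,
    map_zero] at h
  have hvar := mul_nonneg (half_pos hρ).le (variance_nonneg (fun θ : E d => ∑ i, θ i) μs)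
  have hnn : 0 ≤ ∫ θ, ‖act W (θs - θ)‖ ^ 2 ∂μs := integral_nonneg fun θ => by positivity
  have h0 : ∫ θ, ‖act W (θs - θ)‖ ^ 2 ∂μs = 0 := by
    rw [norm_zero] at h
    linarith
  have hf := h2.memLp_act_sub W θs
  rw [integral_eq_zero_iff_of_nonneg (fun θ => by positivity)
    ((memLp_two_iff_integrable_sq_norm hf.1).1 hf)] at h0
  have hae : ∀ᵐ θ ∂μs, θ = θs := by
    filter_upwards [h0] with θ hθ
    have : act W (θs - θ) = act W 0 := by simpa using hθ
    exact (sub_eq_zero.1 (act_injective hW this)).symm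
  have h5 : μs.map id = μs.map fun _ => θs := Measure.map_congr hae
  rwa [Measure.map_id, Measure.map_const, measure_univ, one_smul] at h5

end Minimizer

/-! ### Mean, covariance and `L²` norms compared with a Dirac mass. -/

section Comparison

variable {μ : Measure (E d)}

theorem mean_dirac (a : E d) : mean (Measure.dirac a) = a := by
  simp [mean]

theorem covMat_dirac (a : E d) : covMat (Measure.dirac a) = 0 := by
  ext i j
  simp [covMat, covariance]

theorem bures_zero_right (S : Matrix (Fin d) (Fin d) ℝ) : bures S 0 = √S.trace := by
  simp [bures]

theorem trace_covMat (hμ : InP2 μ) : (covMat μ).trace = ∫ x, ‖x - mean μ‖ ^ 2 ∂μ := by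
  have := hμ.1
  have hi : ∀ i : Fin d, MemLp (fun x : E d => x i - mean μ i) 2 μ := fun i =>
    (EuclideanSpace.proj (𝕜 := ℝ) i).comp_memLp' (hμ.memLp_sub_const (mean μ))
  have hmean : ∀ i : Fin d, ∫ x : E d, x i ∂μ = mean μ i := fun i =>
    (EuclideanSpace.proj (𝕜 := ℝ) i).integral_comp_comm hμ.integrable_id
  simp_rw [EuclideanSpace.real_norm_sq_eq, PiLp.sub_apply]
  rw [integral_finsetSum _ fun i _ => (hi i).integrable_sq]
  refine Finset.sum_congr rfl fun i _ => ?_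
  simp only [Matrix.diag_apply, covMat, Matrix.of_apply, covariance, hmean]
  refine integral_congr_ae (ae_of_all _ fun x => ?_)
  simp [sq]

theorem integral_sq_norm_sub_eq (hμ : InP2 μ) (a : E d) :
    ∫ x, ‖x - a‖ ^ 2 ∂μ = ‖mean μ - a‖ ^ 2 + ∫ x, ‖x - mean μ‖ ^ 2 ∂μ := by
  have := hμ.1
  have h := integral_sq_norm_const_add (hμ.memLp_sub_const (mean μ)) (mean μ - a)
  rw [integral_sub hμ.integrable_id (integrable_const _)] at h
  simpa [mean] using h

theorem sq_norm_mean_sub_le (hμ : InP2 μ) (a : E d) :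
    ‖mean μ - a‖ ^ 2 ≤ ∫ x, ‖x - a‖ ^ 2 ∂μ := by
  rw [integral_sq_norm_sub_eq hμ]
  exact le_add_of_nonneg_right (integral_nonneg fun x => by positivity)

/-- The covariance of the Dirac mass is zero, so the squared Bures distance is the trace of `covMat
μ`, and the identity becomes the bias-variance decomposition. -/
theorem sqrt_mean_add_bures_dirac (hμ : InP2 μ) (a : E d) :
    √(‖mean μ - mean (Measure.dirac a)‖ ^ 2 +
      bures (covMat μ) (covMat (Measure.dirac a)) ^ 2) = W2 μ (Measure.dirac a) := by
  have := hμ.1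
  rw [mean_dirac, covMat_dirac, bures_zero_right, W2_dirac hμ, trace_covMat hμ,
    Real.sq_sqrt (integral_nonneg fun x => by positivity), integral_sq_norm_sub_eq hμ a]

theorem memLp_comp_lipschitz (hμ : InP2 μ) {L : ℝ≥0} {φ : E d → ℝ} (hφ : LipschitzWith L φ) :
    MemLp φ 2 μ := by
  have := hμ.1
  have h : MemLp (fun x => φ x - φ 0) 2 μ := by
    refine hμ.memLp_id.of_le_mul (c := L) (by have := hφ.continuous; fun_prop)
      (ae_of_all _ fun x => ?_)
    simpa using hφ.norm_sub_le x 0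
  simpa [Pi.add_def] using h.add (memLp_const (φ 0))

theorem l2norm_eq_toReal_eLpNorm {φ : E d → ℝ} (hφ : MemLp φ 2 μ) :
    l2norm φ μ = (eLpNorm φ 2 μ).toReal := by
  rw [l2norm, hφ.eLpNorm_eq_integral_rpow_norm two_ne_zero ENNReal.ofNat_ne_top,
    ENNReal.toReal_ofReal (by positivity), Real.sqrt_eq_rpow]
  simp

/-- The norm under the Dirac mass is the `L²(μ)` norm of the constant `φ a`; the reverse triangle
inequality in `L²(μ)` then applies. -/
theorem abs_l2norm_sub_le (hμ : InP2 μ) {L : ℝ≥0} {φ : E d → ℝ} (hφ : LipschitzWith L φ)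
    (a : E d) :
    |l2norm φ μ - l2norm φ (Measure.dirac a)| ≤ L * W2 μ (Measure.dirac a) := by
  have := hμ.1
  have h1 := memLp_comp_lipschitz hμ hφ
  have h2 : MemLp (fun _ : E d => φ a) 2 μ := memLp_const _
  have h3 : l2norm φ (Measure.dirac a) = l2norm (fun _ => φ a) μ := by simp [l2norm]
  have h4 : l2norm (fun x => φ x - φ a) μ ≤ L * W2 μ (Measure.dirac a) := by
    rw [W2_dirac hμ, l2norm, ← Real.sqrt_sq L.coe_nonneg, ← Real.sqrt_mul (sq_nonneg _),
      ← integral_const_mul]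
    refine Real.sqrt_le_sqrt (integral_mono (h1.sub h2).integrable_sq
      ((hμ.integrable_sq_norm_sub a).const_mul _) fun x => ?_)
    have := hφ.norm_sub_le x a
    simp only [Real.norm_eq_abs] at this
    calc (φ x - φ a) ^ 2 = |φ x - φ a| ^ 2 := (sq_abs _).symm
      _ ≤ (L * ‖x - a‖) ^ 2 := by gcongr
      _ = _ := mul_pow _ _ _
  refine le_trans ?_ h4
  have hs : MemLp (fun x => φ x - φ a) 2 μ := h1.sub h2
  rw [h3, l2norm_eq_toReal_eLpNorm h1, l2norm_eq_toReal_eLpNorm h2,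
    l2norm_eq_toReal_eLpNorm hs, abs_sub_le_iff]
  have e1 : eLpNorm φ 2 μ ≤ eLpNorm (fun x => φ x - φ a) 2 μ + eLpNorm (fun _ => φ a) 2 μ := by
    simpa [Pi.add_def, Pi.sub_def] using eLpNorm_add_le hs.1 h2.1 one_le_two
  have e2 : eLpNorm (fun _ => φ a) 2 μ ≤ eLpNorm φ 2 μ + eLpNorm (fun x => φ x - φ a) 2 μ := by
    simpa [Pi.sub_def] using eLpNorm_sub_le h1.1 hs.1 one_le_two
  have e3 := ENNReal.toReal_mono (ENNReal.add_ne_top.2 ⟨hs.2.ne, h2.2.ne⟩) e1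
  have e4 := ENNReal.toReal_mono (ENNReal.add_ne_top.2 ⟨h1.2.ne, hs.2.ne⟩) e2
  rw [ENNReal.toReal_add hs.2.ne h2.2.ne] at e3
  rw [ENNReal.toReal_add h1.2.ne hs.2.ne] at e4
  constructor <;> linarith

end Comparison

/-! ### One-step contraction estimate. -/

section Step

variable {Θ : Set (E d)} {W : Matrix (Fin d) (Fin d) ℝ} {ρ τ : ℝ} {θs : E d} {μ : Measure (E d)}

theorem act_transpose_act_inner_comm (W : Matrix (Fin d) (Fin d) ℝ) (x y : E d) :
    ⟪act Wᵀ (act W x), y⟫ = ⟪x, act Wᵀ (act W y)⟫ := by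
  rw [inner_act_transpose, real_inner_comm, ← inner_act_transpose, real_inner_comm]

/-- Contraction of the noiseless gradient step, up to a term with zero integral. -/
theorem sq_norm_sub_drift_le (hρ : 0 < ρ) (hτ : 0 < τ)
    (hτ' : 2 * max (sigmaMax W ^ 2) ρ * τ ≤ 1) (u ub : E d) :
    ‖u - τ • (act Wᵀ (act W u) + ρ • (u - ub))‖ ^ 2 ≤
      (1 - sigmaMin W ^ 2 * τ) * ‖u‖ ^ 2 - 2 * τ * ρ * ⟪ub, u - ub⟫ := by
  set g := act Wᵀ (act W u) + ρ • (u - ub) with hg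
  set M := max (sigmaMax W ^ 2) ρ with hM
  have h1 : ⟪u, g⟫ = ‖act W u‖ ^ 2 + ρ * (‖u - ub‖ ^ 2 + ⟪ub, u - ub⟫) := by
    rw [hg, inner_add_right, inner_smul_right, real_inner_comm, inner_act_transpose,
      real_inner_self_eq_norm_sq, ← real_inner_self_eq_norm_sq (u - ub), ← inner_add_left,
      sub_add_cancel]
  have h2 : ‖g‖ ^ 2 ≤ 2 * M * (‖act W u‖ ^ 2 + ρ * ‖u - ub‖ ^ 2) := by
    have h3 : ‖g‖ ^ 2 ≤ 2 * (‖act Wᵀ (act W u)‖ ^ 2 + ‖ρ • (u - ub)‖ ^ 2) := by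
      have := parallelogram_law_with_norm ℝ (act Wᵀ (act W u)) (ρ • (u - ub))
      nlinarith [sq_nonneg ‖act Wᵀ (act W u) - ρ • (u - ub)‖]
    have h4 := sq_norm_act_transpose_le W (act W u)
    have h5 : sigmaMax W ^ 2 * ‖act W u‖ ^ 2 ≤ M * ‖act W u‖ ^ 2 := by
      gcongr; exact le_max_left _ _
    have h6 : ρ * (ρ * ‖u - ub‖ ^ 2) ≤ M * (ρ * ‖u - ub‖ ^ 2) := by
      gcongr; exact le_max_right _ _
    rw [norm_smul, mul_pow, Real.norm_eq_abs, sq_abs] at h3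
    linarith
  -- The step-size condition lets the quadratic term consume half of the decrease `2 * τ * ⟪u, g⟫`;
  -- the other half supplies the contraction through `sigmaMin`.
  have h7 : τ ^ 2 * ‖g‖ ^ 2 ≤ τ * (‖act W u‖ ^ 2 + ρ * ‖u - ub‖ ^ 2) :=
    calc τ ^ 2 * ‖g‖ ^ 2 ≤ τ ^ 2 * (2 * M * (‖act W u‖ ^ 2 + ρ * ‖u - ub‖ ^ 2)) := by gcongr
      _ = τ * ((2 * M * τ) * (‖act W u‖ ^ 2 + ρ * ‖u - ub‖ ^ 2)) := by ring
      _ ≤ τ * (1 * (‖act W u‖ ^ 2 + ρ * ‖u - ub‖ ^ 2)) := by gcongr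
      _ = _ := by ring
  have h8 : τ * (sigmaMin W ^ 2 * ‖u‖ ^ 2) ≤ τ * ‖act W u‖ ^ 2 := by
    gcongr; exact le_sq_norm_act W u
  have h9 : 0 ≤ τ * (ρ * ‖u - ub‖ ^ 2) := by positivity
  rw [norm_sub_sq_real, norm_smul, inner_smul_right, mul_pow, Real.norm_eq_abs, sq_abs, h1]
  linarith

/-- Pointwise one-step estimate: contraction, a term affine in `θ` with zero integral, and the
contribution of the noise. -/
theorem sq_norm_proj_step_sub_le (hc : IsClosed Θ) (hconv : Convex ℝ Θ) (hθs : θs ∈ Θ)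
    (hρ : 0 < ρ) (hτ : 0 < τ) (hτ' : 2 * max (sigmaMax W ^ 2) ρ * τ ≤ 1) (w : E d) :
    ∃ a : E d, ∀ θ, ‖proj Θ (θ - τ • grad W ρ μ (act W θs + w) θ) - θs‖ ^ 2 ≤
      (1 - sigmaMin W ^ 2 * τ) * ‖θ - θs‖ ^ 2 + ⟪a, θ - mean μ⟫ +
        (2 * τ * ⟪act W ((mean μ - θs) - τ • act Wᵀ (act W (mean μ - θs))), w⟫ +
          τ ^ 2 * (sigmaMax W ^ 2 * ‖w‖ ^ 2)) := by
  set b := act Wᵀ w with hb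
  set ub := mean μ - θs with hub
  -- The first summand comes from the drift estimate. The second is the slope in `u` of the
  -- drift-noise cross term, expanded about `ub`; its value at `ub` is the noise pairing in the
  -- statement.
  refine ⟨-(2 * τ * ρ) • ub + (2 * τ) • (b - τ • (act Wᵀ (act W b) + ρ • b)), fun θ => ?_⟩
  refine (norm_proj_sub_le hc hconv ⟨θs, hθs⟩ _ hθs).trans ?_
  set u := θ - θs with hu
  have hv : θ - mean μ = u - ub := by rw [hu, hub]; abel
  have hz : θ - τ • grad W ρ μ (act W θs + w) θ - θs =
      (u - τ • (act Wᵀ (act W u) + ρ • (u - ub))) + τ • b := by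
    rw [grad, hv, ← sub_sub, ← map_sub, ← hu, map_sub, ← hb]
    simp only [smul_add, smul_sub]
    rw [hu]
    abel
  have h1 := sq_norm_sub_drift_le (W := W) hρ hτ hτ' u ub
  have h2 : τ ^ 2 * ‖b‖ ^ 2 ≤ τ ^ 2 * (sigmaMax W ^ 2 * ‖w‖ ^ 2) := by
    gcongr; exact sq_norm_act_transpose_le W w
  have h3 : ⟪act W (ub - τ • act Wᵀ (act W ub)), w⟫ =
      ⟪ub, b⟫ - τ * ⟪ub, act Wᵀ (act W b)⟫ := by
    rw [real_inner_comm, ← inner_act_transpose, real_inner_comm, ← hb, inner_sub_left,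
      real_inner_smul_left, act_transpose_act_inner_comm]
  rw [hz, norm_add_sq_real, norm_smul, mul_pow, Real.norm_eq_abs, sq_abs, h3, hv]
  have h4 : ⟪u - τ • (act Wᵀ (act W u) + ρ • (u - ub)), τ • b⟫ =
      τ * (⟪u, b⟫ - τ * (⟪u, act Wᵀ (act W b)⟫ + ρ * (⟪u, b⟫ - ⟪ub, b⟫))) := by
    simp only [inner_smul_right, inner_sub_left, real_inner_smul_left, inner_add_left,
      act_transpose_act_inner_comm]
  have h5 : ⟪-(2 * τ * ρ) • ub + (2 * τ) • (b - τ • (act Wᵀ (act W b) + ρ • b)), u - ub⟫ =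
      -(2 * τ * ρ) * ⟪ub, u - ub⟫ + 2 * τ * ((⟪u, b⟫ - ⟪ub, b⟫) -
        τ * ((⟪u, act Wᵀ (act W b)⟫ - ⟪ub, act Wᵀ (act W b)⟫) + ρ * (⟪u, b⟫ - ⟪ub, b⟫))) := by
    simp only [real_inner_smul_left, inner_sub_left, inner_add_left]
    rw [real_inner_comm (u - ub) b, real_inner_comm (u - ub) (act Wᵀ (act W b))]
    simp only [inner_sub_left]
  rw [h4, h5]
  linarith

theorem memLp_gradStep (hμ : InP2 μ) (y : E d) :
    MemLp (fun θ => θ - τ • grad W ρ μ y θ) 2 μ := by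
  have := hμ.1
  have h1 : MemLp (fun θ => act Wᵀ (act W θ - y)) 2 μ :=
    (LinearMap.toContinuousLinearMap (act Wᵀ)).comp_memLp' ((hμ.memLp_act W).sub (memLp_const y))
  exact hμ.memLp_id.sub ((h1.add ((hμ.memLp_sub_const (mean μ)).const_smul ρ)).const_smul τ)

theorem inP2_step (hc : IsClosed Θ) (hconv : Convex ℝ Θ) (hne : Θ.Nonempty) (hμ : InP2 μ)
    (y : E d) : InP2 (μ.map fun θ => proj Θ (θ - τ • grad W ρ μ y θ)) :=
  have := hμ.1
  hμ.map (memLp_proj_comp hc hconv hne (memLp_gradStep hμ y))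

theorem integral_sq_norm_step_le (hc : IsClosed Θ) (hconv : Convex ℝ Θ) (hθs : θs ∈ Θ)
    (hρ : 0 < ρ) (hτ : 0 < τ) (hτ' : 2 * max (sigmaMax W ^ 2) ρ * τ ≤ 1) (hμ : InP2 μ) (w : E d) :
    ∫ θ, ‖θ - θs‖ ^ 2 ∂(μ.map fun θ => proj Θ (θ - τ • grad W ρ μ (act W θs + w) θ)) ≤
      (1 - sigmaMin W ^ 2 * τ) * ∫ θ, ‖θ - θs‖ ^ 2 ∂μ +
        (2 * τ * ⟪act W ((mean μ - θs) - τ • act Wᵀ (act W (mean μ - θs))), w⟫ +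
          τ ^ 2 * (sigmaMax W ^ 2 * ‖w‖ ^ 2)) := by
  have := hμ.1
  have hp := memLp_proj_comp hc hconv ⟨θs, hθs⟩
    (memLp_gradStep (W := W) (ρ := ρ) (τ := τ) hμ (act W θs + w))
  obtain ⟨a, ha⟩ := sq_norm_proj_step_sub_le (W := W) (μ := μ) hc hconv hθs hρ hτ hτ' w
  have h1 : Integrable (fun θ : E d => ⟪a, θ - mean μ⟫) μ :=
    (hμ.integrable_id.sub (integrable_const _)).const_inner a
  have h2 := (hμ.integrable_sq_norm_sub θs).const_mul (1 - sigmaMin W ^ 2 * τ)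
  have h0 : Integrable (fun θ : E d => θ - mean μ) μ :=
    hμ.integrable_id.sub (integrable_const _)
  have h3 : ∫ θ : E d, ⟪a, θ - mean μ⟫ ∂μ = 0 := by
    rw [integral_inner h0, integral_sub hμ.integrable_id (integrable_const _)]
    simp [mean]
  have hs := hp.sub (memLp_const θs)
  rw [integral_map hp.1.aemeasurable (by fun_prop)]
  refine (integral_mono ((memLp_two_iff_integrable_sq_norm hs.1).1 hs)
    ((h2.add h1).add (integrable_const _)) ha).trans_eq ?_
  rw [integral_add' (h2.add h1) (integrable_const _), integral_add' h2 h1, integral_const_mul, h3]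
  simp

end Step

/-! ### Particle flow and measurability in the noise. -/

section Flow

variable {Θ : Set (E d)} {W : Matrix (Fin d) (Fin d) ℝ} {ρ τ : ℝ} {μ₀ : Measure (E d)}

/-- The particle flow of the iteration, as a function of the initial position. -/
noncomputable def flow (Θ : Set (E d)) (W : Matrix (Fin d) (Fin d) ℝ) (ρ τ : ℝ)
    (μ₀ : Measure (E d)) (y : ℕ → E d) : ℕ → E d → E d
  | 0 => id
  | k + 1 => fun θ =>
    proj Θ (flow Θ W ρ τ μ₀ y k θ - τ • (act Wᵀ (act W (flow Θ W ρ τ μ₀ y k θ) - y k) +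
      ρ • (flow Θ W ρ τ μ₀ y k θ - ∫ x, flow Θ W ρ τ μ₀ y k x ∂μ₀)))

/-- Writing the random measure as the image of the fixed `μ₀` under a jointly measurable map reduces
measurability of its integrals to Fubini. Only `y j` with `j < k` enters, which later makes the
iterates predictable. -/
theorem measurable_flow_prod (hc : IsClosed Θ) (hconv : Convex ℝ Θ) (hne : Θ.Nonempty)
    [SFinite μ₀] {Ω : Type*} [MeasurableSpace Ω] {y : ℕ → Ω → E d} (k : ℕ)
    (hy : ∀ j < k, Measurable (y j)) :
    Measurable fun p : Ω × E d => flow Θ W ρ τ μ₀ (fun j => y j p.1) k p.2 := by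
  induction k with
  | zero => exact measurable_snd
  | succ k ih =>
    have h := ih fun j hj => hy j (by omega)
    have hint : Measurable fun p : Ω × E d =>
        ∫ x, flow Θ W ρ τ μ₀ (fun j => y j p.1) k x ∂μ₀ :=
      h.stronglyMeasurable.integral_prod_right'.measurable.comp measurable_fst
    have hyk : Measurable fun p : Ω × E d => y k p.1 := (hy k (by omega)).comp measurable_fst
    have h1 := (continuous_act W).measurable
    have h2 := (continuous_act Wᵀ).measurable
    exact (measurable_proj hc hconv hne).comp (h.sub
      (((h2.comp ((h1.comp h).sub hyk)).add ((h.sub hint).const_smul ρ)).const_smul τ))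

theorem measurable_flow (hc : IsClosed Θ) (hconv : Convex ℝ Θ) (hne : Θ.Nonempty)
    [SFinite μ₀] (y : ℕ → E d) (k : ℕ) : Measurable (flow Θ W ρ τ μ₀ y k) :=
  (measurable_flow_prod (Ω := Unit) (y := fun j _ => y j) hc hconv hne k
    fun _ _ => measurable_const).comp (measurable_const (a := ()) |>.prodMk measurable_id)

theorem iter_eq_map_flow (hc : IsClosed Θ) (hconv : Convex ℝ Θ) (hne : Θ.Nonempty)
    [SFinite μ₀] (y : ℕ → E d) (k : ℕ) :
    iter Θ W ρ τ μ₀ y k = μ₀.map (flow Θ W ρ τ μ₀ y k) := by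
  induction k with
  | zero => exact Measure.map_id.symm
  | succ k ih =>
    have h := measurable_flow (W := W) (ρ := ρ) (τ := τ) (μ₀ := μ₀) hc hconv hne y k
    have hm : mean (iter Θ W ρ τ μ₀ y k) = ∫ x, flow Θ W ρ τ μ₀ y k x ∂μ₀ := by
      rw [mean, ih, integral_map h.aemeasurable (by fun_prop)]
    have h1 := (continuous_act W).measurable
    have h2 := (continuous_act Wᵀ).measurable
    have h3 : Measurable fun θ => proj Θ (θ - τ • grad W ρ (iter Θ W ρ τ μ₀ y k) (y k) θ) :=
      (measurable_proj hc hconv hne).comp (by unfold grad; fun_prop)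
    rw [iter]
    -- Only the measure being pushed forward is rewritten; the copy inside `grad` stays so that `hm`
    -- applies.
    conv_lhs => rw [show Measure.map _ (iter Θ W ρ τ μ₀ y k) =
      Measure.map (fun θ => proj Θ (θ - τ • grad W ρ (iter Θ W ρ τ μ₀ y k) (y k) θ))
        (μ₀.map (flow Θ W ρ τ μ₀ y k)) by rw [← ih]]
    rw [Measure.map_map h3 h]
    congr 1
    ext1 θ
    simp only [Function.comp_apply, grad, hm, flow]

theorem stronglyMeasurable_integral_iter (hc : IsClosed Θ) (hconv : Convex ℝ Θ)
    (hne : Θ.Nonempty) [SFinite μ₀] {Ω : Type*} [MeasurableSpace Ω] {y : ℕ → Ω → E d} (k : ℕ)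
    (hy : ∀ j < k, Measurable (y j)) {F : Type*} [NormedAddCommGroup F] [NormedSpace ℝ F]
    [SecondCountableTopology F] {g : E d → F} (hg : Continuous g) :
    StronglyMeasurable fun ω => ∫ x, g x ∂(iter Θ W ρ τ μ₀ (fun j => y j ω) k) := by
  borelize F
  have h := hg.measurable.comp
    (measurable_flow_prod (W := W) (ρ := ρ) (τ := τ) (μ₀ := μ₀) hc hconv hne k hy)
  convert! h.stronglyMeasurable.integral_prod_right' (ν := μ₀) using 2 with ω
  rw [iter_eq_map_flow hc hconv hne,
    integral_map (measurable_flow hc hconv hne _ k).aemeasurable hg.aestronglyMeasurable]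
  rfl

theorem inP2_iter (hc : IsClosed Θ) (hconv : Convex ℝ Θ) (hne : Θ.Nonempty) (hμ₀ : InP2 μ₀)
    (y : ℕ → E d) (k : ℕ) : InP2 (iter Θ W ρ τ μ₀ y k) := by
  induction k with
  | zero => exact hμ₀
  | succ k ih => exact inP2_step hc hconv hne ih (y k)

end Flow

/-! ### Vanishing martingale term and Jensen's inequality. -/

section Expectation

variable {Ω : Type*} {mΩ : MeasurableSpace Ω} {P : Measure Ω}

theorem integral_inner_of_condExp_eq_zero [IsFiniteMeasure P] {m : MeasurableSpace Ω}
    (hm : m ≤ mΩ) {X w : Ω → E d} (hX : StronglyMeasurable[m] X) (hX2 : MemLp X 2 P)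
    (hw2 : MemLp w 2 P) (hcond : P[w | m] =ᵐ[P] 0) :
    Integrable (fun ω => ⟪X ω, w ω⟫) P ∧ ∫ ω, ⟪X ω, w ω⟫ ∂P = 0 := by
  have hint : Integrable (fun ω => ⟪X ω, w ω⟫) P := by
    refine ((hX2.integrable_norm_pow two_ne_zero).add
      (hw2.integrable_norm_pow two_ne_zero)).mono (hX2.1.inner hw2.1) (ae_of_all _ fun ω => ?_)
    simp only [Pi.add_apply]
    rw [Real.norm_of_nonneg (add_nonneg (sq_nonneg _) (sq_nonneg _))]
    have h1 := norm_inner_le_norm (𝕜 := ℝ) (X ω) (w ω)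
    nlinarith [sq_nonneg (‖X ω‖ - ‖w ω‖), norm_nonneg (X ω), norm_nonneg (w ω)]
  refine ⟨hint, ?_⟩
  have h := condExp_bilin_of_stronglyMeasurable_left (innerSL ℝ) hX hint
    (hw2.integrable one_le_two)
  have h0 : P[fun ω => ⟪X ω, w ω⟫ | m] =ᵐ[P] 0 := by
    filter_upwards [h, hcond] with ω h1 h2
    refine h1.trans ?_
    simp [h2]
  rw [← integral_condExp hm, integral_congr_ae h0]
  simp

/-- Jensen for the square root, obtained from nonnegativity of the variance of `√V`. -/
theorem integrable_sqrt_and_integral_le [IsProbabilityMeasure P] {V : Ω → ℝ}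
    (hV : Integrable V P) (h0 : ∀ ω, 0 ≤ V ω) :
    Integrable (fun ω => √(V ω)) P ∧ ∫ ω, √(V ω) ∂P ≤ √(∫ ω, V ω ∂P) := by
  have hm : AEStronglyMeasurable (fun ω => √(V ω)) P :=
    Real.continuous_sqrt.comp_aestronglyMeasurable hV.1
  have hsq : (fun ω => √(V ω) ^ 2) = V := funext fun ω => Real.sq_sqrt (h0 ω)
  have h2 : MemLp (fun ω => √(V ω)) 2 P := (memLp_two_iff_integrable_sq hm).2 (by rwa [hsq])
  refine ⟨h2.integrable one_le_two, Real.le_sqrt_of_sq_le ?_⟩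
  have h3 := variance_nonneg (fun ω => √(V ω)) P
  rw [variance_eq_sub h2] at h3
  have h4 : (fun ω => √(V ω)) ^ 2 = V := hsq
  rw [h4] at h3
  linarith

end Expectation

/-! ### Affine recursions and their limits. -/

section Recursion

/-- The hypothesis on `N` makes `B / 4` dominate the equilibrium of the recursion. The factor 4 is
slack spent on shifting the exponent below. -/
theorem le_of_affine_recursion {e : ℕ → ℝ} {c B N : ℝ} (hc0 : 0 ≤ c)
    (hN : 4 * N ≤ B * (1 - c)) (h : ∀ k, e (k + 1) ≤ c * e k + N) (k : ℕ) :
    e k ≤ c ^ k * e 0 + B / 4 * (1 - c ^ k) := by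
  induction k with
  | zero => simp
  | succ k ih =>
    have := mul_le_mul_of_nonneg_left ih hc0
    rw [pow_succ]
    linarith [h k]

theorem le_pow_mul_sub_add {e : ℕ → ℝ} {c B N : ℝ} (hc0 : 0 ≤ c) (hc1 : c ≤ 1) (hB : 0 ≤ B)
    (hN : 4 * N ≤ B * (1 - c)) (h : ∀ k, e (k + 1) ≤ c * e k + N) (k : ℕ) :
    e k ≤ c ^ k * (e 0 - B) + B := by
  have h1 := le_of_affine_recursion hc0 hN h k
  have h2 := mul_nonneg hB (sub_nonneg.2 (pow_le_one₀ hc0 hc1 (n := k)))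
  linarith

theorem succ_le_pow_mul_sub_add {e : ℕ → ℝ} {c B N : ℝ} (hc0 : 0 ≤ c) (hc1 : c ≤ 1) (hB : 0 ≤ B)
    (hN : 4 * N ≤ B * (1 - c)) (h : ∀ k, e (k + 1) ≤ c * e k + N) (he : 0 ≤ e 0) {k : ℕ}
    (hk : 1 ≤ k) : e (k + 1) ≤ c ^ k * (e 0 - B) + B := by
  have h1 := le_of_affine_recursion hc0 hN h (k + 1)
  have h2 : c ^ k ≤ c := by simpa using pow_le_pow_of_le_one hc0 hc1 hk
  have h3 : c ^ (k + 1) * e 0 ≤ c ^ k * e 0 :=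
    mul_le_mul_of_nonneg_right (pow_le_pow_of_le_one hc0 hc1 (by omega)) he
  -- Here `k ≥ 1` matters: `c ^ k ≤ c` gives `1 - c ^ (k + 1) ≤ 2 * (1 - c ^ k)`, while at `k = 0`
  -- the right side is zero.
  have h4 : 1 - c ^ (k + 1) ≤ 4 * (1 - c ^ k) := by
    rw [pow_succ]
    nlinarith [mul_nonneg (sub_nonneg.2 hc1) (sub_nonneg.2 (h2.trans hc1))]
  have h5 := mul_le_mul_of_nonneg_left h4 (by positivity : 0 ≤ B / 4)
  linarith

theorem limsup_coe_le_of_le_mul_sqrt {a e : ℕ → ℝ} {L c B D : ℝ} (hc0 : 0 ≤ c) (hc1 : c < 1)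
    (hL : 0 ≤ L) (ha : ∀ k, a k ≤ L * √(e k)) (he : ∀ k, e k ≤ c ^ (k + 1) * D + B) :
    limsup (fun k => (a k : EReal)) atTop ≤ ((L * √B : ℝ) : EReal) := by
  have h1 : Tendsto (fun k : ℕ => c ^ (k + 1) * D + B) atTop (𝓝 B) := by
    simpa using (((tendsto_pow_atTop_nhds_zero_of_lt_one hc0 hc1).comp
      (tendsto_add_atTop_nat 1)).mul_const D).add_const B
  have h2 : Tendsto (fun k : ℕ => ((L * √(c ^ (k + 1) * D + B) : ℝ) : EReal)) atTop
      (𝓝 ((L * √B : ℝ) : EReal)) :=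
    (continuous_coe_real_ereal.tendsto _).comp
      (((Real.continuous_sqrt.tendsto _).comp h1).const_mul L)
  rw [← h2.limsup_eq]
  refine limsup_le_limsup (Eventually.of_forall fun k => ?_)
  exact EReal.coe_le_coe_iff.2 ((ha k).trans (by gcongr; exact he k))

end Recursion

/-! ### One-step estimate in expectation. -/

section ExpectedStep

theorem measurable_iSup_comap {Ω : Type*} {w : ℕ → Ω → E d} {j k : ℕ} (hj : j < k) :
    Measurable[⨆ j < k, MeasurableSpace.comap (w j) inferInstance] (w j) := by
  rw [measurable_iff_comap_le]
  exact le_iSup₂ (f := fun j (_ : j < k) => MeasurableSpace.comap (w j) inferInstance) j hj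

variable {Θ : Set (E d)} {W : Matrix (Fin d) (Fin d) ℝ} {ρ τ : ℝ} {μ₀ : Measure (E d)} {θs : E d}
  {Ω : Type*} [mΩ : MeasurableSpace Ω] {P : Measure Ω} [IsProbabilityMeasure P]
  {w : ℕ → Ω → E d}

theorem integrable_and_integral_sq_norm_iter_succ_le (hc : IsClosed Θ) (hconv : Convex ℝ Θ)
    (hθs : θs ∈ Θ) (hρ : 0 < ρ) (hτ : 0 < τ) (hτ' : 2 * max (sigmaMax W ^ 2) ρ * τ ≤ 1)
    (hμ₀ : InP2 μ₀) (hw : ∀ k, Measurable (w k)) (hw2 : ∀ k, MemLp (w k) 2 P)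
    (hcond : ∀ k, P[w k | ⨆ j < k, MeasurableSpace.comap (w j) inferInstance] =ᵐ[P] 0) (k : ℕ) :
    Integrable
        (fun ω => ∫ θ, ‖θ - θs‖ ^ 2 ∂iter Θ W ρ τ μ₀ (fun j => act W θs + w j ω) k) P ∧
      ∫ ω, ∫ θ, ‖θ - θs‖ ^ 2 ∂iter Θ W ρ τ μ₀ (fun j => act W θs + w j ω) (k + 1) ∂P ≤
        (1 - sigmaMin W ^ 2 * τ) *
            ∫ ω, ∫ θ, ‖θ - θs‖ ^ 2 ∂iter Θ W ρ τ μ₀ (fun j => act W θs + w j ω) k ∂P +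
          τ ^ 2 * (sigmaMax W ^ 2 * ∫ ω, ‖w k ω‖ ^ 2 ∂P) := by
  have hne : Θ.Nonempty := ⟨θs, hθs⟩
  have := hμ₀.1
  set μ : ℕ → Ω → Measure (E d) := fun k ω => iter Θ W ρ τ μ₀ (fun j => act W θs + w j ω) k
    with hμ_def
  have hμ : ∀ k ω, InP2 (μ k ω) := fun k ω => inP2_iter hc hconv hne hμ₀ _ k
  set V : ℕ → Ω → ℝ := fun k ω => ∫ θ, ‖θ - θs‖ ^ 2 ∂μ k ω with hV_def
  have hV0 : ∀ k ω, 0 ≤ V k ω := fun k ω => integral_nonneg fun θ => by positivity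
  have hVm : ∀ k, StronglyMeasurable (V k) := fun k =>
    stronglyMeasurable_integral_iter (y := fun j ω => act W θs + w j ω) hc hconv hne k
      (fun j _ => (hw j).const_add _) (by fun_prop)
  let T : E d →L[ℝ] E d := LinearMap.toContinuousLinearMap
    (act W ∘ₗ (LinearMap.id - τ • (act Wᵀ ∘ₗ act W)))
  have hT : ∀ x, T x = act W (x - τ • act Wᵀ (act W x)) := fun x => rfl
  set X : ℕ → Ω → E d := fun k ω => T (mean (μ k ω) - θs) with hX_def
  have hm : ∀ k, (⨆ j < k, MeasurableSpace.comap (w j) inferInstance) ≤ mΩ := fun k =>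
    iSup₂_le fun j _ => (hw j).comap_le
  have hXm : ∀ k, StronglyMeasurable[⨆ j < k, MeasurableSpace.comap (w j) inferInstance]
      (X k) := fun k => by
    refine T.continuous.comp_stronglyMeasurable (StronglyMeasurable.sub ?_
      stronglyMeasurable_const)
    -- The measurable space on `Ω` is given explicitly as the σ-algebra of the noise before time
    -- `k`, the one on which `w k` is conditionally centred.
    exact @stronglyMeasurable_integral_iter d Θ W ρ τ μ₀ hc hconv hne _ Ω
      (⨆ j < k, MeasurableSpace.comap (w j) inferInstance) (fun j ω => act W θs + w j ω) k
      (fun j hj => (measurable_iSup_comap hj).const_add _) _ _ _ _ _ continuous_id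
  have hX2 : ∀ k, Integrable (V k) P → MemLp (X k) 2 P := fun k hk => by
    have hXm' := ((hXm k).mono (hm k)).aestronglyMeasurable (μ := P)
    refine (memLp_two_iff_integrable_sq_norm hXm').2 ((hk.const_mul (‖T‖ ^ 2)).mono
      (hXm'.norm.pow 2) (ae_of_all _ fun ω => ?_))
    rw [Real.norm_of_nonneg (by positivity),
      Real.norm_of_nonneg (mul_nonneg (by positivity) (hV0 k ω))]
    calc ‖X k ω‖ ^ 2 ≤ (‖T‖ * ‖mean (μ k ω) - θs‖) ^ 2 := by gcongr; exact T.le_opNorm _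
      _ = ‖T‖ ^ 2 * ‖mean (μ k ω) - θs‖ ^ 2 := mul_pow _ _ _
      _ ≤ _ := by gcongr; exact sq_norm_mean_sub_le (hμ k ω) θs
  have hstep : ∀ k ω, V (k + 1) ω ≤ (1 - sigmaMin W ^ 2 * τ) * V k ω +
      (2 * τ * ⟪X k ω, w k ω⟫ + τ ^ 2 * (sigmaMax W ^ 2 * ‖w k ω‖ ^ 2)) := fun k ω =>
    integral_sq_norm_step_le hc hconv hθs hρ hτ hτ' (hμ k ω) (w k ω)
  have hnoise : ∀ k, Integrable (fun ω => τ ^ 2 * (sigmaMax W ^ 2 * ‖w k ω‖ ^ 2)) P := fun k =>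
    (((memLp_two_iff_integrable_sq_norm (hw2 k).1).1 (hw2 k)).const_mul _).const_mul _
  have hinner := fun k hk => integral_inner_of_condExp_eq_zero (hm k) (hXm k) (hX2 k hk) (hw2 k)
    (hcond k)
  -- Integrability must propagate along the recursion: the pairing of `X k` with `w k` is integrable
  -- because `V k` controls `‖X k‖ ^ 2`.
  have hVint : ∀ k, Integrable (V k) P := fun k => by
    induction k with
    | zero => exact integrable_const (∫ θ, ‖θ - θs‖ ^ 2 ∂μ₀)
    | succ k ih =>
      refine ((ih.const_mul (1 - sigmaMin W ^ 2 * τ)).add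
        (((hinner k ih).1.const_mul (2 * τ)).add (hnoise k))).mono
        (hVm (k + 1)).aestronglyMeasurable (ae_of_all _ fun ω => ?_)
      rw [Real.norm_of_nonneg (hV0 _ ω)]
      exact (hstep k ω).trans (le_abs_self _)
  refine ⟨hVint k, ?_⟩
  obtain ⟨h1, h2⟩ := hinner k (hVint k)
  have h3 := (hVint k).const_mul (1 - sigmaMin W ^ 2 * τ)
  refine (integral_mono (hVint (k + 1)) (h3.add ((h1.const_mul (2 * τ)).add (hnoise k)))
    (hstep k)).trans_eq ?_
  rw [integral_add' h3 ((h1.const_mul (2 * τ)).add (hnoise k)),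
    integral_add' (h1.const_mul (2 * τ)) (hnoise k), integral_const_mul, integral_const_mul,
    integral_const_mul, integral_const_mul, h2, mul_zero, zero_add]

end ExpectedStep

end WassersteinSGD

/-! ### Assembly of the conclusions. -/

theorem corollary2 {d : ℕ}
    -- the constraint set, the linear model and the true parameter
    (Θ : Set (WassersteinSGD.E d)) (hΘc : IsClosed Θ) (hΘconv : Convex ℝ Θ)
    (W : Matrix (Fin d) (Fin d) ℝ) (hW : IsUnit W)
    (θs : WassersteinSGD.E d) (hθs : θs ∈ Θ)
    (ρ : ℝ) (hρ : 0 < ρ)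
    -- the noise: common law `ν`, mean zero, variance `σw ^ 2`, conditionally centred
    {Ω : Type*} [MeasurableSpace Ω] (P : Measure Ω) [IsProbabilityMeasure P]
    (w : ℕ → Ω → WassersteinSGD.E d) (hw : ∀ k, Measurable (w k))
    (ν : Measure (WassersteinSGD.E d)) (hlaw : ∀ k, P.map (w k) = ν)
    (σw : ℝ) (hσw : 0 < σw)
    (hν2 : Integrable (fun x => ‖x‖ ^ 2) ν)
    (hν0 : ∫ x, x ∂ν = 0) (hνvar : ∫ x, ‖x‖ ^ 2 ∂ν = σw ^ 2)
    (hcond : ∀ k, P[w k | ⨆ j < k, MeasurableSpace.comap (w j) inferInstance] =ᵐ[P] 0)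
    -- the data stream
    (y : ℕ → Ω → WassersteinSGD.E d)
    (hy : ∀ k ω, y k ω = WassersteinSGD.act W θs + w k ω)
    -- step size, initial condition, iterates and optimal solution
    (τ : ℝ) (hτ : τ ∈ Ioo 0 (1 / (2 * max (WassersteinSGD.sigmaMax W ^ 2) ρ)))
    (μ₀ : Measure (WassersteinSGD.E d)) (hμ₀ : WassersteinSGD.InP2 μ₀)
    (μ : ℕ → Ω → Measure (WassersteinSGD.E d))
    (hμ : ∀ k ω, μ k ω = WassersteinSGD.iter Θ W ρ τ μ₀ (fun j => y j ω) k)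
    (μs : Measure (WassersteinSGD.E d)) (hμs : WassersteinSGD.IsOptimal Θ W ρ θs ν μs) :
    -- the iterates lie in `P₂`, and each is the unique Wasserstein projection of the gradient step
    (∀ k ω, WassersteinSGD.InP2 (μ k ω)) ∧
    (∀ k ω (μ' : Measure (WassersteinSGD.E d)),
      WassersteinSGD.IsSupportProj Θ (WassersteinSGD.gradStep W ρ τ (μ k ω) (y k ω)) μ' ↔
        μ' = μ (k + 1) ω) ∧
    -- the finite-time bound, after `k + 1` steps
    (∀ k, Integrable (fun ω => WassersteinSGD.W2 (μ (k + 1) ω) μs ^ 2) P ∧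
      ∫ ω, WassersteinSGD.W2 (μ (k + 1) ω) μs ^ 2 ∂P ≤
        (1 - WassersteinSGD.sigmaMin W ^ 2 * τ) ^ (k + 1) *
            (WassersteinSGD.W2 μ₀ μs ^ 2 - τ * WassersteinSGD.eta W ρ * σw ^ 2) +
          τ * WassersteinSGD.eta W ρ * σw ^ 2) ∧
    -- the same bound with exponent `k`, from the second step on
    (∀ k, 1 ≤ k → ∫ ω, WassersteinSGD.W2 (μ (k + 1) ω) μs ^ 2 ∂P ≤
        (1 - WassersteinSGD.sigmaMin W ^ 2 * τ) ^ k *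
            (WassersteinSGD.W2 μ₀ μs ^ 2 - τ * WassersteinSGD.eta W ρ * σw ^ 2) +
          τ * WassersteinSGD.eta W ρ * σw ^ 2) ∧
    -- asymptotic bound on the Wasserstein distance
    ((∀ k, Integrable (fun ω => WassersteinSGD.W2 (μ (k + 1) ω) μs) P) ∧
      limsup (fun k => ((∫ ω, WassersteinSGD.W2 (μ (k + 1) ω) μs ∂P : ℝ) : EReal)) atTop ≤
        ((σw * √(WassersteinSGD.eta W ρ * τ) : ℝ) : EReal)) ∧
    -- asymptotic bound on means and covariances
    ((∀ k, Integrable (fun ω =>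
        √(‖WassersteinSGD.mean (μ (k + 1) ω) - WassersteinSGD.mean μs‖ ^ 2 +
          WassersteinSGD.bures (WassersteinSGD.covMat (μ (k + 1) ω))
            (WassersteinSGD.covMat μs) ^ 2)) P) ∧
      limsup (fun k => ((∫ ω,
        √(‖WassersteinSGD.mean (μ (k + 1) ω) - WassersteinSGD.mean μs‖ ^ 2 +
          WassersteinSGD.bures (WassersteinSGD.covMat (μ (k + 1) ω))
            (WassersteinSGD.covMat μs) ^ 2) ∂P : ℝ) : EReal)) atTop ≤
        ((σw * √(WassersteinSGD.eta W ρ * τ) : ℝ) : EReal)) ∧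
    -- asymptotic bound for Lipschitz functions
    (∀ (L : ℝ≥0) (φ : WassersteinSGD.E d → ℝ), LipschitzWith L φ →
      (∀ k, Integrable (fun ω =>
        |WassersteinSGD.l2norm φ (μ (k + 1) ω) - WassersteinSGD.l2norm φ μs|) P) ∧
      limsup (fun k => ((∫ ω,
        |WassersteinSGD.l2norm φ (μ (k + 1) ω) - WassersteinSGD.l2norm φ μs| ∂P : ℝ) : EReal))
        atTop ≤ (((L : ℝ) * (σw * √(WassersteinSGD.eta W ρ * τ)) : ℝ) : EReal)) := by
  have hne : Θ.Nonempty := ⟨θs, hθs⟩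
  obtain ⟨hτ0, hτ1⟩ := hτ
  have hP : IsProbabilityMeasure ν := hlaw 0 ▸ Measure.isProbabilityMeasure_map (hw 0).aemeasurable
  -- In dimension zero the noise would have zero variance; positivity of `d` makes the index `d - 1`
  -- in `sigmaMin` genuine.
  have hd : 0 < d := by
    rcases Nat.eq_zero_or_pos d with rfl | h
    · have h0 : ∀ x : WassersteinSGD.E 0, ‖x‖ ^ 2 = 0 := fun x => by simp [Subsingleton.elim x 0]
      simp_rw [h0, integral_zero] at hνvar
      exact absurd hνvar.symm (by positivity)
    · exact h
  set M := max (WassersteinSGD.sigmaMax W ^ 2) ρ with hM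
  have hM0 : 0 < M := lt_max_of_lt_right hρ
  have hτM : 2 * M * τ ≤ 1 := by
    rw [lt_div_iff₀ (by positivity)] at hτ1
    linarith
  have hs0 : 0 < WassersteinSGD.sigmaMin W := WassersteinSGD.sigmaMin_pos hW hd
  have hsM : WassersteinSGD.sigmaMin W ^ 2 ≤ M :=
    (pow_le_pow_left₀ hs0.le (WassersteinSGD.sigmaMin_le_sigmaMax W) 2).trans (le_max_left _ _)
  set c := 1 - WassersteinSGD.sigmaMin W ^ 2 * τ with hc
  have hc1 : c < 1 := by
    have : 0 < WassersteinSGD.sigmaMin W ^ 2 * τ := by positivity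
    linarith
  have hc0 : 0 ≤ c := by
    have : WassersteinSGD.sigmaMin W ^ 2 * τ ≤ M * τ := by gcongr
    linarith
  have hη : 0 ≤ WassersteinSGD.eta W ρ := by
    rw [WassersteinSGD.eta]
    positivity
  set B := τ * WassersteinSGD.eta W ρ * σw ^ 2 with hB
  have hB0 : 0 ≤ B := by positivity
  -- The 4 in `eta` gives `B * (1 - c) = 4 * τ ^ 2 * M * σw ^ 2`, four times the noise term with
  -- `sigmaMax W ^ 2` enlarged to `M`.
  have hN : 4 * (τ ^ 2 * (WassersteinSGD.sigmaMax W ^ 2 * σw ^ 2)) ≤ B * (1 - c) := by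
    have h1 : B * (1 - c) = 4 * (τ ^ 2 * (M * σw ^ 2)) := by
      rw [hB, hc, WassersteinSGD.eta, ← hM]
      field_simp
      ring
    rw [h1]
    gcongr
    exact le_max_left _ _
  have hBsqrt : √B = σw * √(WassersteinSGD.eta W ρ * τ) := by
    rw [hB, mul_comm, Real.sqrt_mul (sq_nonneg _), Real.sqrt_sq hσw.le, mul_comm τ]
  obtain rfl := hμs.eq_dirac hΘc hW hθs hρ ⟨hP, hν2⟩ hν0
  obtain rfl : y = fun k ω => WassersteinSGD.act W θs + w k ω := funext₂ hy
  obtain rfl : μ = fun k ω => WassersteinSGD.iter Θ W ρ τ μ₀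
      (fun j => WassersteinSGD.act W θs + w j ω) k := funext₂ hμ
  have hP2 : ∀ k ω, WassersteinSGD.InP2 (WassersteinSGD.iter Θ W ρ τ μ₀
      (fun j => WassersteinSGD.act W θs + w j ω) k) := fun k ω =>
    WassersteinSGD.inP2_iter hΘc hΘconv hne hμ₀ _ k
  have hwint : ∀ k, Integrable (fun ω => ‖w k ω‖ ^ 2) P := fun k => by
    rw [← hlaw k] at hν2
    exact (integrable_map_measure (by fun_prop) (hw k).aemeasurable).1 hν2
  have hwvar : ∀ k, ∫ ω, ‖w k ω‖ ^ 2 ∂P = σw ^ 2 := fun k => by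
    rw [← hνvar, ← hlaw k, integral_map (hw k).aemeasurable (by fun_prop)]
  have hmain := WassersteinSGD.integrable_and_integral_sq_norm_iter_succ_le (W := W) (P := P)
    hΘc hΘconv hθs hρ hτ0 hτM hμ₀ hw
    (fun k => (memLp_two_iff_integrable_sq_norm (hw k).aestronglyMeasurable).2 (hwint k)) hcond
  simp_rw [hwvar, ← WassersteinSGD.sq_W2_dirac (hP2 _ _)] at hmain
  set e : ℕ → ℝ := fun k => ∫ ω, WassersteinSGD.W2 (WassersteinSGD.iter Θ W ρ τ μ₀
      (fun j => WassersteinSGD.act W θs + w j ω) k) (Measure.dirac θs) ^ 2 ∂P with he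
  have he0 : e 0 = WassersteinSGD.W2 μ₀ (Measure.dirac θs) ^ 2 := by
    simp [he, WassersteinSGD.iter]
  have hrec : ∀ k, e (k + 1) ≤ c * e k + τ ^ 2 * (WassersteinSGD.sigmaMax W ^ 2 * σw ^ 2) :=
    fun k => (hmain k).2
  have hbound := WassersteinSGD.le_pow_mul_sub_add hc0 hc1.le hB0 hN hrec
  have hW2 := fun k => WassersteinSGD.integrable_sqrt_and_integral_le (hmain (k + 1)).1
    fun ω => sq_nonneg _
  simp_rw [Real.sqrt_sq (show 0 ≤ WassersteinSGD.W2 _ _ from ENNReal.toReal_nonneg)] at hW2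
  have hlim : limsup (fun k => ((∫ ω, WassersteinSGD.W2 (WassersteinSGD.iter Θ W ρ τ μ₀
      (fun j => WassersteinSGD.act W θs + w j ω) (k + 1)) (Measure.dirac θs) ∂P : ℝ) : EReal))
      atTop ≤ ((σw * √(WassersteinSGD.eta W ρ * τ) : ℝ) : EReal) := by
    rw [← hBsqrt, ← one_mul √B]
    exact WassersteinSGD.limsup_coe_le_of_le_mul_sqrt (e := fun k => e (k + 1)) hc0 hc1 zero_le_one
      (fun k => (hW2 k).2.trans_eq (one_mul _).symm) fun k => hbound (k + 1)
  refine ⟨hP2, fun k ω μ' => ?_, fun k => ⟨(hmain (k + 1)).1, ?_⟩, fun k hk => ?_,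
    ⟨fun k => (hW2 k).1, hlim⟩, ?_, fun L φ hφ => ?_⟩
  · have hstep := WassersteinSGD.memLp_gradStep (W := W) (ρ := ρ) (τ := τ) (hP2 k ω)
      (WassersteinSGD.act W θs + w k ω)
    have hgs : WassersteinSGD.InP2 (WassersteinSGD.gradStep W ρ τ (WassersteinSGD.iter Θ W ρ τ μ₀
        (fun j => WassersteinSGD.act W θs + w j ω) k) (WassersteinSGD.act W θs + w k ω)) :=
      (hP2 k ω).map hstep
    rw [WassersteinSGD.isSupportProj_iff hΘc hΘconv hne hgs, WassersteinSGD.gradStep,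
      AEMeasurable.map_map_of_aemeasurable
        (WassersteinSGD.measurable_proj hΘc hΘconv hne).aemeasurable hstep.1.aemeasurable]
    rfl
  · rw [← he0]
    exact hbound (k + 1)
  · rw [← he0]
    exact WassersteinSGD.succ_le_pow_mul_sub_add hc0 hc1.le hB0 hN hrec
      (integral_nonneg fun ω => sq_nonneg _) hk
  · simp_rw [WassersteinSGD.sqrt_mean_add_bures_dirac (hP2 _ _)]
    exact ⟨fun k => (hW2 k).1, hlim⟩
  · have := hμ₀.1
    have hle := fun k ω => WassersteinSGD.abs_l2norm_sub_le (hP2 (k + 1) ω) hφ θs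
    have hint : ∀ k, Integrable (fun ω => |WassersteinSGD.l2norm φ (WassersteinSGD.iter Θ W ρ τ μ₀
        (fun j => WassersteinSGD.act W θs + w j ω) (k + 1)) -
          WassersteinSGD.l2norm φ (Measure.dirac θs)|) P := fun k => by
      have hm := WassersteinSGD.stronglyMeasurable_integral_iter (W := W) (ρ := ρ) (τ := τ)
        (μ₀ := μ₀) (y := fun j ω => WassersteinSGD.act W θs + w j ω) hΘc hΘconv hne (k + 1)
        (fun j _ => (hw j).const_add _) (hφ.continuous.pow 2)
      have hm2 := Real.continuous_sqrt.comp_stronglyMeasurable hm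
      refine ((hW2 k).1.const_mul (L : ℝ)).mono
        (hm2.sub stronglyMeasurable_const).norm.aestronglyMeasurable (ae_of_all _ fun ω => ?_)
      rw [Real.norm_eq_abs, abs_abs]
      exact (hle k ω).trans (le_abs_self _)
    refine ⟨hint, ?_⟩
    rw [← hBsqrt]
    refine WassersteinSGD.limsup_coe_le_of_le_mul_sqrt (e := fun k => e (k + 1)) hc0 hc1
      L.coe_nonneg (fun k => ?_) fun k => hbound (k + 1)
    refine (integral_mono (hint k) ((hW2 k).1.const_mul (L : ℝ)) (hle k)).trans ?_
    rw [integral_const_mul]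
    gcongr
    exact (hW2 k).2
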